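/- Let $(a;q)_k=\prod_{j=0}^{k-1}(1-aq^j)$ and $(a,b;q)_k=(a;q)_k(b;q)_k$, and let $\Phi_n(q)$ be the $n$-th cyclotomic polynomial. For rational functions $A(q),B(q)\in\mathbb{Q}(q)$ write $A(q)\equiv B(q)\pmod{\Phi_n(q)}$ if $\Phi_n(q)$ divides the numerator of $A(q)-B(q)$ written in lowest terms. Then for every positive integer $n\equiv1\pmod 4$, modulo $\Phi_n(q)$, $$\sum_{k=0}^{(n-1)/2}\frac{(q;q^2)_k^2\,(q^2;q^4)_k}{(q^2;q^2)_k^2\,(q^4;q^4)_k}\,(-q)^k\equiv\begin{cases}\dfrac{(q,q^2;q^4)_{(n-1)/8}^2\,(-q;q)_{(n-1)/2}}{(q^4;q^4)_{(n-1)/4}^2}\,q^{-(1-n)^2/4}&\text{if }n\equiv1\pmod 8,\\[6pt]0&\text{if }n\equiv5\pmod 8.\end{cases}$$ -/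

import Mathlib

open Polynomial

/-- The `q`-shifted factorial `(a; q)_k = (1 - a) (1 - a q) ⋯ (1 - a q ^ (k - 1))`. -/
def qPochhammer {R : Type*} [CommRing R] (a q : R) (k : ℕ) : R :=
  ∏ j ∈ Finset.range k, (1 - a * q ^ j)

/-- Congruence of rational functions modulo a polynomial: `A ≡ B` modulo `P` when `P` divides the
numerator of `A - B`, written in lowest terms (`RatFunc.num` is the numerator of the reduced
fraction, hence the denominator of `A - B` is then coprime to `P`). -/
def RatFuncModEq (P : ℚ[X]) (A B : RatFunc ℚ) : Prop :=
  P ∣ (A - B).num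

/-- The truncated sum `∑_{k=0}^{(n-1)/2} (q;q²)_k² (q²;q⁴)_k / ((q²;q²)_k² (q⁴;q⁴)_k) (-q)^k`. -/
def truncatedSum {K : Type*} [Field K] (q : K) (n : ℕ) : K :=
  ∑ k ∈ Finset.range ((n - 1) / 2 + 1),
    qPochhammer q (q ^ 2) k ^ 2 * qPochhammer (q ^ 2) (q ^ 4) k /
      (qPochhammer (q ^ 2) (q ^ 2) k ^ 2 * qPochhammer (q ^ 4) (q ^ 4) k) * (-q) ^ k

/-! ### Elementary identities for shifted factorials. -/

section Pochhammer

variable {R : Type*} [CommRing R]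

/-! `Φ_n` is the minimal polynomial of a primitive `n`-th root of unity `ζ`, so two rational
functions regular at `ζ` are congruent as soon as their values there agree. The task becomes an
identity at `q = ζ`.

Write `n = 2N + 1`. The factor `q^k (q;q²)_k² / (q²;q²)_k²` of the summand is itself a terminating
balanced `₃φ₂` (`sum_saalschutzTerm`); inserting it gives a double sum over `k` and `j`. For fixed
`j`, reversing products by means of `q^n = 1` turns the sum over `k` into a convolution, evaluated
by the `q`-binomial theorem (`sum_qBinomialCoeff_sq`). With `N = 2M`, what remains is a constant
times a balanced `₄φ₃` of base `q²` (`sum_doubleTerm_eq_watsonTerm`). That series obeys a two-term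
recurrence from `M` to `M + 2`, with value `1` at `M = 0` and `0` at `M = 1`; the parity of `M =
(n-1)/4` therefore separates the two cases. -/

@[simp] lemma qPochhammer_zero (a q : R) : qPochhammer a q 0 = 1 := by simp [qPochhammer]

lemma qPochhammer_succ (a q : R) (k : ℕ) :
    qPochhammer a q (k + 1) = qPochhammer a q k * (1 - a * q ^ k) := by
  simp [qPochhammer, Finset.prod_range_succ]

lemma qPochhammer_add (a q : R) (k l : ℕ) :
    qPochhammer a q (k + l) = qPochhammer a q k * qPochhammer (a * q ^ k) q l := by
  simp only [qPochhammer, Finset.prod_range_add]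
  congr 1
  exact Finset.prod_congr rfl fun i _ => by ring

lemma qPochhammer_succ' (a q : R) (k : ℕ) :
    qPochhammer a q (k + 1) = (1 - a) * qPochhammer (a * q) q k := by
  rw [add_comm, qPochhammer_add, qPochhammer_succ]
  simp

lemma qPochhammer_two_mul (a q : R) (k : ℕ) :
    qPochhammer a q (2 * k) = qPochhammer a (q ^ 2) k * qPochhammer (a * q) (q ^ 2) k := by
  induction k with
  | zero => simp
  | succ k ih =>
    rw [mul_add, mul_one, qPochhammer_succ, qPochhammer_succ, ih, qPochhammer_succ,
      qPochhammer_succ]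
    ring

lemma qPochhammer_sq (a q : R) (k : ℕ) :
    qPochhammer (a ^ 2) (q ^ 2) k = qPochhammer a q k * qPochhammer (-a) q k := by
  simp only [qPochhammer, ← Finset.prod_mul_distrib]
  exact Finset.prod_congr rfl fun i _ => by ring

lemma qPochhammer_eq_zero {a q : R} {i k : ℕ} (hik : i < k) (h : a * q ^ i = 1) :
    qPochhammer a q k = 0 :=
  Finset.prod_eq_zero (Finset.mem_range.2 hik) (by rw [h, sub_self])

lemma qPochhammer_ne_zero [IsDomain R] {a q : R} {k : ℕ} (h : ∀ i < k, a * q ^ i ≠ 1) :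
    qPochhammer a q k ≠ 0 :=
  Finset.prod_ne_zero_iff.2 fun i hi => sub_ne_zero.2 (h i (Finset.mem_range.1 hi)).symm

lemma qPochhammer_self_ne_zero [IsDomain R] {q : R} {k : ℕ} (h : ∀ i < k, q ^ (i + 1) ≠ 1) :
    qPochhammer q q k ≠ 0 :=
  qPochhammer_ne_zero fun i hi => by rw [← pow_succ']; exact h i hi

end Pochhammer

/-! ### Convolution of `q`-binomial coefficients and telescoping certificates. -/

section Summations

variable {K : Type*} [Field K]

/-- The coefficients `(b; q)_i / (q; q)_i` of the `q`-binomial series. -/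
def qBinomialCoeff (b q : K) (i : ℕ) : K := qPochhammer b q i / qPochhammer q q i

lemma qBinomialCoeff_succ (b q : K) (i : ℕ) (h : q ^ (i + 1) ≠ 1) :
    (1 - q ^ (i + 1)) * qBinomialCoeff b q (i + 1) = (1 - b * q ^ i) * qBinomialCoeff b q i := by
  have h' : 1 - q ^ (i + 1) ≠ 0 := sub_ne_zero.2 h.symm
  rw [qBinomialCoeff, qBinomialCoeff, qPochhammer_succ, qPochhammer_succ, ← pow_succ']
  -- If `(q;q)_i = 0`, both coefficients are `0` by the convention `x / 0 = 0`.
  by_cases h0 : qPochhammer q q i = 0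
  · simp [h0]
  · field_simp

/-- The product of the `q²`-binomial series in `t` and in `q t` is the `q`-binomial series. -/
lemma sum_qBinomialCoeff_sq (b q : K) (L : ℕ) (h : ∀ i < L, q ^ (i + 1) ≠ 1)
    (h2 : ∀ i < L, (q ^ 2) ^ (i + 1) ≠ 1) :
    ∑ i ∈ Finset.range (L + 1),
      qBinomialCoeff b (q ^ 2) i * qBinomialCoeff b (q ^ 2) (L - i) * q ^ (L - i)
      = qBinomialCoeff b q L := by
  induction L with
  | zero => simp [qBinomialCoeff]
  | succ L ih =>
    have ih := ih (fun i hi => h i (by omega)) (fun i hi => h2 i (by omega))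
    have hL : 1 - q ^ (L + 1) ≠ 0 := sub_ne_zero.2 (h L (by omega)).symm
    apply mul_left_cancel₀ hL
    rw [qBinomialCoeff_succ b q L (h L (by omega)), ← ih]
    set f := qBinomialCoeff b (q ^ 2) with hf
    -- Reflection exchanges the weights `q^(n-i)` and `q^i`. Since `q^(2i) q^(n-i) = q^n q^i`, it
    -- lets a factor `1 - c q^(2i)` leave the sum as `1 - c q^n`; this is used with `c = 1` and `c =
    -- b`.
    have symm : ∀ n : ℕ, ∑ i ∈ Finset.range (n + 1), f i * f (n - i) * q ^ (n - i) =
        ∑ i ∈ Finset.range (n + 1), f i * f (n - i) * q ^ i := by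
      intro n
      rw [← Finset.sum_range_reflect]
      refine Finset.sum_congr rfl fun i hi => ?_
      have hi := Finset.mem_range.1 hi
      have e1 : n + 1 - 1 - i = n - i := by omega
      have e2 : n - (n - i) = i := by omega
      rw [e1, e2]
      ring
    have key : ∑ i ∈ Finset.range (L + 2), (1 - (q ^ 2) ^ i) * f i * (f (L + 1 - i) * q ^ (L + 1 - i))
        = ∑ i ∈ Finset.range (L + 1), (1 - b * (q ^ 2) ^ i) * f i * (f (L - i) * q ^ (L - i)) := by
      rw [Finset.sum_range_succ']
      simp only [pow_zero, sub_self, zero_mul, add_zero]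
      refine Finset.sum_congr rfl fun i hi => ?_
      have hi := Finset.mem_range.1 hi
      rw [hf, qBinomialCoeff_succ b (q ^ 2) i (h2 i (by omega)), Nat.add_sub_add_right]
    have lhs : ∑ i ∈ Finset.range (L + 2), (1 - (q ^ 2) ^ i) * f i * (f (L + 1 - i) * q ^ (L + 1 - i))
        = (1 - q ^ (L + 1)) * ∑ i ∈ Finset.range (L + 2), f i * f (L + 1 - i) * q ^ (L + 1 - i) := by
      rw [sub_mul, one_mul, symm (L + 1) |> congrArg (q ^ (L + 1) * ·), Finset.mul_sum,
        ← Finset.sum_sub_distrib]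
      refine Finset.sum_congr rfl fun i hi => ?_
      have hi := Finset.mem_range.1 hi
      obtain ⟨m, hm⟩ : ∃ m, L + 1 = i + m := ⟨L + 1 - i, by omega⟩
      rw [hm, Nat.add_sub_cancel_left]
      ring
    have rhs : ∑ i ∈ Finset.range (L + 1), (1 - b * (q ^ 2) ^ i) * f i * (f (L - i) * q ^ (L - i))
        = (1 - b * q ^ L) * ∑ i ∈ Finset.range (L + 1), f i * f (L - i) * q ^ (L - i) := by
      rw [sub_mul, one_mul, symm L |> congrArg (b * q ^ L * ·), Finset.mul_sum,
        ← Finset.sum_sub_distrib]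
      refine Finset.sum_congr rfl fun i hi => ?_
      have hi := Finset.mem_range.1 hi
      obtain ⟨m, hm⟩ : ∃ m, L = i + m := ⟨L - i, by omega⟩
      rw [hm, Nat.add_sub_cancel_left]
      ring
    rw [← lhs, ← rhs, key]

/-- The summand of the balanced `₃φ₂` series of base `q²` with upper parameters
`q^(-2k)`, `q^(2k+1)`, `q` and lower parameters `q²`, `q²`. -/
def saalschutzTerm (q : K) (k j : ℕ) : K :=
  qPochhammer ((q ^ 2) ^ k)⁻¹ (q ^ 2) j * qPochhammer (q * (q ^ 2) ^ k) (q ^ 2) j *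
    qPochhammer q (q ^ 2) j / qPochhammer (q ^ 2) (q ^ 2) j ^ 3 * (q ^ 2) ^ j

lemma saalschutzTerm_eq_zero {q : K} (hq : q ≠ 0) {k j : ℕ} (h : k < j) :
    saalschutzTerm q k j = 0 := by
  rw [saalschutzTerm, qPochhammer_eq_zero h (by field_simp)]
  simp

lemma qPochhammer_shift (a q : K) (j : ℕ) :
    (1 - a) * qPochhammer (a * q) q j = qPochhammer a q j * (1 - a * q ^ j) := by
  rw [← qPochhammer_succ', qPochhammer_succ]

/-- A Zeilberger certificate for a first-order recurrence in `k`. The right side vanishes at `J = 0`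
through `(1 - q^(2J))³`, and for `J > k + 1` through `(q^(-2(k+1)); q²)_J`, so the complete sums
satisfy the recurrence without remainder. -/
lemma saalschutzTerm_telescope {q : K} (hq : q ≠ 0) {k : ℕ} (hk : q * (q ^ 2) ^ k ≠ 1)
    (hk2 : (q ^ 2) ^ (k + 1) ≠ 1) (J : ℕ) (hJ : ∀ i < J, (q ^ 2) ^ (i + 1) ≠ 1) :
    ∑ j ∈ Finset.range J, ((1 - (q ^ 2) ^ (k + 1)) ^ 2 * saalschutzTerm q (k + 1) j -
      q * (1 - q * (q ^ 2) ^ k) ^ 2 * saalschutzTerm q k j) =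
    qPochhammer ((q ^ 2) ^ (k + 1))⁻¹ (q ^ 2) J * qPochhammer (q * (q ^ 2) ^ k) (q ^ 2) J *
      qPochhammer q (q ^ 2) J / qPochhammer (q ^ 2) (q ^ 2) J ^ 3 *
      ((1 - (q ^ 2) ^ J) ^ 3 * q ^ 2 * (q ^ 2) ^ k * (1 - q ^ 3 * ((q ^ 2) ^ k) ^ 2) /
        ((1 - q * (q ^ 2) ^ k) * ((q ^ 2) ^ (k + 1) - 1))) := by
  induction J with
  | zero => simp
  | succ J ih =>
    rw [Finset.sum_range_succ, ih fun i hi => hJ i (by omega)]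
    have hJJ := hJ J (by omega)
    have h0 : qPochhammer (q ^ 2) (q ^ 2) J ≠ 0 :=
      qPochhammer_self_ne_zero fun i hi => hJ i (by omega)
    -- Products for `k` and `k + 1` differ by ratios of linear factors, so the induction step
    -- reduces to a rational identity in `q`, `y = q^(2k)` and `x = q^(2J)`.
    have e1 := qPochhammer_shift (q * (q ^ 2) ^ k) (q ^ 2) J
    have e2 := qPochhammer_shift ((q ^ 2) ^ (k + 1))⁻¹ (q ^ 2) J
    rw [mul_assoc q, ← pow_succ] at e1
    have e3 : ((q ^ 2) ^ (k + 1))⁻¹ * q ^ 2 = ((q ^ 2) ^ k)⁻¹ := by field_simp; ring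
    rw [e3] at e2
    simp only [saalschutzTerm, qPochhammer_succ]
    generalize qPochhammer (q * (q ^ 2) ^ k) (q ^ 2) J = A at *
    generalize qPochhammer (q * (q ^ 2) ^ (k + 1)) (q ^ 2) J = A' at *
    generalize qPochhammer ((q ^ 2) ^ (k + 1))⁻¹ (q ^ 2) J = B at *
    generalize qPochhammer ((q ^ 2) ^ k)⁻¹ (q ^ 2) J = B' at *
    generalize qPochhammer (q ^ 2) (q ^ 2) J = D at *
    generalize qPochhammer q (q ^ 2) J = C at *
    have hy0 : (q ^ 2) ^ k ≠ 0 := by positivity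
    simp only [pow_succ (q ^ 2)] at *
    generalize (q ^ 2) ^ k = y at *
    generalize (q ^ 2) ^ J = x at *
    have n1 : 1 - q * y ≠ 0 := sub_ne_zero.2 hk.symm
    have n2 : y * q ^ 2 - 1 ≠ 0 := sub_ne_zero.2 hk2
    have n2' : q ^ 2 * y - 1 ≠ 0 := by rwa [mul_comm]
    have n3 : 1 - x * q ^ 2 ≠ 0 := sub_ne_zero.2 hJJ.symm
    have n3' : 1 - q ^ 2 * x ≠ 0 := by rwa [mul_comm]
    have e1' : A' = A * (1 - q * y * x) / (1 - q * y) := by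
      rw [eq_div_iff n1]; linear_combination e1
    have e2' : B' = B * (y * q ^ 2 - x) / (y * q ^ 2 - 1) := by
      rw [eq_div_iff n2]; field_simp at e2; linear_combination e2
    rw [e1', e2']
    clear e1 e2 e1' e2' e3 ih
    field_simp
    ring

/-- The certificate's recurrence, solved from `k = 0`. As terms with `j > k` vanish, the range `J`
can stay fixed while `k` varies. -/
lemma sum_saalschutzTerm {q : K} (hq : q ≠ 0) (k : ℕ) (h1 : ∀ i < k, q * (q ^ 2) ^ i ≠ 1)
    (h2 : ∀ i ≤ k, (q ^ 2) ^ (i + 1) ≠ 1) (J : ℕ) (hkJ : k < J)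
    (hJ : ∀ i < J, (q ^ 2) ^ (i + 1) ≠ 1) :
    ∑ j ∈ Finset.range J, saalschutzTerm q k j =
      q ^ k * qPochhammer q (q ^ 2) k ^ 2 / qPochhammer (q ^ 2) (q ^ 2) k ^ 2 := by
  induction k with
  | zero =>
    rw [Finset.sum_eq_single 0]
    · simp [saalschutzTerm]
    · intro j _ hj
      exact saalschutzTerm_eq_zero hq (Nat.pos_of_ne_zero hj)
    · simp; omega
  | succ k ih =>
    have ih := ih (fun i hi => h1 i (by omega)) (fun i hi => h2 i (by omega)) (by omega)
    have tel := saalschutzTerm_telescope hq (h1 k (by omega)) (h2 k (by omega)) J hJ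
    rw [Finset.sum_sub_distrib, ← Finset.mul_sum, ← Finset.mul_sum, ih,
      qPochhammer_eq_zero hkJ (by field_simp)] at tel
    have n2 : 1 - q ^ 2 * (q ^ 2) ^ k ≠ 0 := by
      rw [← pow_succ']; exact sub_ne_zero.2 (h2 k (by omega)).symm
    have h0 : qPochhammer (q ^ 2) (q ^ 2) k ≠ 0 :=
      qPochhammer_self_ne_zero fun i hi => h2 i (by omega)
    rw [qPochhammer_succ, qPochhammer_succ]
    rw [eq_div_iff (by positivity)]
    simp only [zero_mul, zero_div, pow_succ' (q ^ 2)] at tel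
    field_simp at tel
    linear_combination tel

/-- The summand of the balanced `₄φ₃` series of base `p` with upper parameters
`p^(-m)`, `p^(m+1)`, `√p`, `-√p` and lower parameters `p`, `p`, `-p`. -/
def watsonTerm (p : K) (m j : ℕ) : K :=
  qPochhammer (p ^ m)⁻¹ p j * qPochhammer (p ^ (m + 1)) p j * qPochhammer p (p ^ 2) j /
    (qPochhammer p p j ^ 2 * qPochhammer (p ^ 2) (p ^ 2) j) * p ^ j

lemma watsonTerm_eq_zero {p : K} (hp : p ≠ 0) {m j : ℕ} (h : m < j) : watsonTerm p m j = 0 := by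
  rw [watsonTerm, qPochhammer_eq_zero h (by field_simp)]
  simp

/-- A certificate of the same kind, but linking `m` to `m + 2` with no `m + 1` term: this is the
source of the parity dichotomy. -/
lemma watsonTerm_telescope {p : K} (hp : p ≠ 0) {m : ℕ} (hm1 : p ^ (m + 1) ≠ 1)
    (hm2 : p ^ (m + 2) ≠ 1) (J : ℕ) (hJ : ∀ i < J, p ^ (i + 1) ≠ 1)
    (hJ2 : ∀ i < J, (p ^ 2) ^ (i + 1) ≠ 1) :
    ∑ j ∈ Finset.range J, ((1 - p ^ (m + 2)) ^ 2 * watsonTerm p (m + 2) j -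
      p * (1 - p ^ (m + 1)) ^ 2 * watsonTerm p m j) =
    -(qPochhammer (p ^ (m + 2))⁻¹ p J * qPochhammer (p ^ (m + 1)) p J * qPochhammer p (p ^ 2) J /
      ((1 - p ^ (m + 1)) * (1 - p ^ (m + 2)) *
        (qPochhammer p p J ^ 2 * qPochhammer (p ^ 2) (p ^ 2) J)) *
      (p ^ (m + 2) * (1 - p * (p ^ (m + 1)) ^ 2) * (1 - p ^ J) ^ 2 * (1 - (p ^ 2) ^ J))) := by
  induction J with
  | zero => simp
  | succ J ih =>
    rw [Finset.sum_range_succ, ih (fun i hi => hJ i (by omega)) (fun i hi => hJ2 i (by omega))]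
    have hJJ := hJ J (by omega)
    have hJJ2 := hJ2 J (by omega)
    have h0 : qPochhammer p p J ≠ 0 :=
      qPochhammer_self_ne_zero fun i hi => hJ i (by omega)
    have h02 : qPochhammer (p ^ 2) (p ^ 2) J ≠ 0 :=
      qPochhammer_self_ne_zero fun i hi => hJ2 i (by omega)
    have e1 := qPochhammer_shift (p ^ (m + 1)) p J
    have e1' := qPochhammer_shift (p ^ (m + 2)) p J
    have e2 := qPochhammer_shift (p ^ (m + 2))⁻¹ p J
    have e2' := qPochhammer_shift (p ^ (m + 1))⁻¹ p J
    rw [← pow_succ] at e1 e1'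
    have e3 : (p ^ (m + 2))⁻¹ * p = (p ^ (m + 1))⁻¹ := by field_simp; ring
    have e4 : (p ^ (m + 1))⁻¹ * p = (p ^ m)⁻¹ := by field_simp; ring
    rw [e3] at e2
    rw [e4] at e2'
    simp only [add_assoc, Nat.reduceAdd] at e1 e1'
    simp only [watsonTerm, qPochhammer_succ, add_assoc, Nat.reduceAdd]
    generalize qPochhammer (p ^ (m + 1)) p J = A at *
    generalize qPochhammer (p ^ (m + 2)) p J = A' at *
    generalize qPochhammer (p ^ (m + 3)) p J = A'' at *
    generalize qPochhammer (p ^ (m + 2))⁻¹ p J = B at *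
    generalize qPochhammer (p ^ (m + 1))⁻¹ p J = B' at *
    generalize qPochhammer (p ^ m)⁻¹ p J = B'' at *
    generalize qPochhammer p p J = D at *
    generalize qPochhammer (p ^ 2) (p ^ 2) J = D' at *
    generalize qPochhammer p (p ^ 2) J = C at *
    have hy0 : p ^ (m + 1) ≠ 0 := by positivity
    have em : p ^ (m + 2) = p * p ^ (m + 1) := by ring
    have em2 : (p ^ 2) ^ J = (p ^ J) ^ 2 := by ring
    simp only [pow_succ _ J, em, em2] at *
    clear em em2 e3 e4 ih
    generalize p ^ (m + 1) = y at *
    generalize p ^ J = x at *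
    have n1 : 1 - y ≠ 0 := sub_ne_zero.2 hm1.symm
    have n2 : 1 - p * y ≠ 0 := sub_ne_zero.2 hm2.symm
    have n1' : y - 1 ≠ 0 := sub_ne_zero.2 hm1
    have n2' : p * y - 1 ≠ 0 := sub_ne_zero.2 hm2
    have n2'' : y * p - 1 ≠ 0 := by rwa [mul_comm]
    have n3 : 1 - x * p ≠ 0 := sub_ne_zero.2 hJJ.symm
    have n3' : 1 - p * x ≠ 0 := by rwa [mul_comm]
    have n4 : 1 - x ^ 2 * p ^ 2 ≠ 0 := sub_ne_zero.2 hJJ2.symm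
    have n4' : 1 - p ^ 2 * x ^ 2 ≠ 0 := by rwa [mul_comm]
    have f1 : A' = A * (1 - y * x) / (1 - y) := by
      rw [eq_div_iff n1]; linear_combination e1
    have f1' : A'' = A * (1 - y * x) * (1 - p * y * x) / ((1 - y) * (1 - p * y)) := by
      rw [f1] at e1'; rw [eq_div_iff (mul_ne_zero n1 n2)]; field_simp at e1'
      linear_combination e1'
    have f2 : B' = B * (p * y - x) / (p * y - 1) := by
      rw [eq_div_iff n2']; field_simp at e2; linear_combination e2
    have f2' : B'' = B * (p * y - x) * (y - x) / ((y - 1) * (p * y - 1)) := by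
      rw [f2] at e2'; rw [eq_div_iff (mul_ne_zero n1' n2')]; field_simp at e2'
      linear_combination e2'
    have g1 : (y - 1) = -(1 - y) := by ring
    have g2 : (p * y - 1) = -(1 - p * y) := by ring
    rw [g1, g2] at f2'
    rw [f1', f2']
    clear e1 e2 e1' e2' f1 f1' f2 f2' g1 g2
    field_simp
    ring

end Summations

/-! ### Evaluation of the `₄φ₃` by parity. -/

section Watson

variable {K : Type*} [Field K]

lemma sum_watsonTerm_add_two {p : K} (hp : p ≠ 0) {m J : ℕ} (hmJ : m + 2 < J)
    (hJ : ∀ i < J, (p ^ 2) ^ (i + 1) ≠ 1) :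
    (1 - p ^ (m + 2)) ^ 2 * ∑ j ∈ Finset.range J, watsonTerm p (m + 2) j =
      p * (1 - p ^ (m + 1)) ^ 2 * ∑ j ∈ Finset.range J, watsonTerm p m j := by
  have h1 : ∀ i < J, p ^ (i + 1) ≠ 1 := fun i hi h => hJ i hi (by
    rw [← pow_mul, mul_comm, pow_mul, h, one_pow])
  have tel := watsonTerm_telescope hp (h1 m (by omega)) (h1 (m + 1) (by omega)) J h1 hJ
  rw [Finset.sum_sub_distrib, ← Finset.mul_sum, ← Finset.mul_sum,
    qPochhammer_eq_zero hmJ (by field_simp)] at tel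
  linear_combination tel

lemma sum_watsonTerm_odd {p : K} (hp : p ≠ 0) {k J : ℕ} (hkJ : 2 * k + 1 < J)
    (hJ : ∀ i < J, (p ^ 2) ^ (i + 1) ≠ 1) :
    ∑ j ∈ Finset.range J, watsonTerm p (2 * k + 1) j = 0 := by
  have h1 : ∀ i < J, p ^ (i + 1) ≠ 1 := fun i hi h => hJ i hi (by
    rw [← pow_mul, mul_comm, pow_mul, h, one_pow])
  induction k with
  | zero =>
    have n1 : 1 - p ≠ 0 := sub_ne_zero.2 (by simpa using (h1 0 (by omega)).symm)
    have n2 : 1 - p ^ 2 ≠ 0 := sub_ne_zero.2 (by simpa using (hJ 0 (by omega)).symm)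
    -- For `m = 1` only `j = 0` and `j = 1` survive, contributing `1` and `-1`.
    obtain ⟨J, rfl⟩ : ∃ J', J = 2 + J' := ⟨J - 2, by omega⟩
    rw [Finset.sum_range_add, Finset.sum_eq_zero (s := Finset.range J) fun j _ =>
      watsonTerm_eq_zero hp (by omega)]
    simp only [watsonTerm, qPochhammer, Finset.sum_range_succ, Finset.sum_range_zero,
      Finset.prod_range_succ, Finset.prod_range_zero]
    simp
    field_simp
    ring
  | succ k ih =>
    have h := sum_watsonTerm_add_two hp (m := 2 * k + 1) (by omega) hJ
    rw [ih (by omega), mul_zero] at h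
    have n : 1 - p ^ (2 * k + 1 + 2) ≠ 0 := sub_ne_zero.2 (h1 (2 * k + 2) (by omega)).symm
    exact (mul_eq_zero.1 h).resolve_left (pow_ne_zero 2 n)

lemma sum_watsonTerm_even {p : K} (hp : p ≠ 0) {k J : ℕ} (hkJ : 2 * k < J)
    (hJ : ∀ i < J, (p ^ 2) ^ (i + 1) ≠ 1) :
    ∑ j ∈ Finset.range J, watsonTerm p (2 * k) j =
      p ^ k * qPochhammer p (p ^ 2) k ^ 2 / qPochhammer (p ^ 2) (p ^ 2) k ^ 2 := by
  have h1 : ∀ i < J, p ^ (i + 1) ≠ 1 := fun i hi h => hJ i hi (by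
    rw [← pow_mul, mul_comm, pow_mul, h, one_pow])
  induction k with
  | zero =>
    rw [Finset.sum_eq_single 0]
    · simp [watsonTerm]
    · intro j _ hj
      exact watsonTerm_eq_zero hp (by omega)
    · simp; omega
  | succ k ih =>
    have h := sum_watsonTerm_add_two hp (m := 2 * k) (by omega) hJ
    rw [ih (by omega)] at h
    have n : 1 - p ^ (2 * k + 2) ≠ 0 := sub_ne_zero.2 (h1 (2 * k + 1) (by omega)).symm
    have h0 : qPochhammer (p ^ 2) (p ^ 2) k ≠ 0 :=
      qPochhammer_self_ne_zero fun i hi => hJ i (by omega)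
    have e1 : p ^ 2 * (p ^ 2) ^ k = p ^ (2 * k + 2) := by ring
    have e2 : p * (p ^ 2) ^ k = p ^ (2 * k + 1) := by ring
    rw [mul_add, mul_one, qPochhammer_succ, qPochhammer_succ, e1, e2]
    apply mul_left_cancel₀ (pow_ne_zero 2 n)
    rw [h]
    field_simp
    ring

end Watson

/-! ### Reversal of finite products. -/

section Reversal

variable {K : Type*} [Field K]

/-- The hypothesis makes `b` the inverse of the last argument `a q^(2(m-1))`; apply `1 - x = -x (1 -
x⁻¹)` to every factor. The extra `q^m` on the left avoids the exponent `m² - m`. -/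
lemma qPochhammer_reverse {q : K} (hq : q ≠ 0) (a b : K) (m : ℕ)
    (h : a * b * q ^ (2 * m) = q ^ 2) :
    qPochhammer a (q ^ 2) m * q ^ m = (-a) ^ m * q ^ (m ^ 2) * qPochhammer b (q ^ 2) m := by
  induction m generalizing b with
  | zero => simp
  | succ m ih =>
    have h' : a * q ^ (2 * m) * b = 1 := by
      apply mul_right_cancel₀ (pow_ne_zero 2 hq)
      linear_combination h
    rw [qPochhammer_succ, qPochhammer_succ']
    have ih := ih (b * q ^ 2) (by linear_combination h)
    have e : (-a) ^ (m + 1) * q ^ ((m + 1) ^ 2) = (-a) ^ m * q ^ (m ^ 2) * (-a * q ^ (2 * m) * q) := by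
      ring
    rw [e, ← pow_mul]
    linear_combination (1 - a * q ^ (2 * m)) * q * ih -
      (-a) ^ m * q ^ (m ^ 2) * q * qPochhammer (b * q ^ 2) (q ^ 2) m * h'

lemma qPochhammer_inv_mul {q : K} (hq : q ≠ 0) (i j : ℕ) :
    qPochhammer (q ^ 2) (q ^ 2) (j + i) =
      (-1) ^ j * q ^ (2 * i * j + j + j ^ 2) * qPochhammer ((q ^ 2) ^ (j + i))⁻¹ (q ^ 2) j *
        qPochhammer (q ^ 2) (q ^ 2) i := by
  have h := qPochhammer_reverse hq (q ^ 2 * (q ^ 2) ^ i) ((q ^ 2) ^ (j + i))⁻¹ j (by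
    field_simp; ring)
  rw [add_comm j i, qPochhammer_add]
  rw [add_comm j i] at h
  apply mul_right_cancel₀ (pow_ne_zero j hq)
  rw [mul_assoc, h, neg_pow]
  ring

/-- Reversal of `(q; q²)_m` when `q` is a root of unity of odd order. -/
lemma qPochhammer_odd_reverse {q : K} (hq : q ≠ 0) {m l : ℕ} (h : q ^ (2 * (m + l) + 1) = 1) :
    qPochhammer q (q ^ 2) m * qPochhammer (q ^ 2) (q ^ 2) l =
      (-1) ^ m * q ^ (m ^ 2) * qPochhammer (q ^ 2) (q ^ 2) (m + l) := by
  have h := qPochhammer_reverse hq q (q ^ 2 * (q ^ 2) ^ l) m (by linear_combination q ^ 2 * h)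
  rw [add_comm m l, qPochhammer_add]
  apply mul_right_cancel₀ (pow_ne_zero m hq)
  rw [mul_right_comm, h, neg_pow]
  ring

/-- Reversal of `(-q²; q²)_m` when `q` is a root of unity of odd order. -/
lemma qPochhammer_neg_reverse {q : K} (hq : q ≠ 0) {m l : ℕ} (h : q ^ (2 * (m + l) + 1) = 1) :
    qPochhammer (-q ^ 2) (q ^ 2) m * qPochhammer (-q) (q ^ 2) l =
      q ^ (m * (m + 1)) * qPochhammer (-q) (q ^ 2) (m + l) := by
  have h := qPochhammer_reverse hq (-q ^ 2) (-q * (q ^ 2) ^ l) m (by linear_combination q ^ 2 * h)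
  rw [add_comm m l, qPochhammer_add]
  apply mul_right_cancel₀ (pow_ne_zero m hq)
  rw [mul_right_comm, h]
  ring

/-- The tail of `(q; q)_{2 (j + l)}` when `q` is a root of unity of order `4 (j + l) + 1`. -/
lemma qPochhammer_self_reverse {q : K} (hq : q ≠ 0) {j l : ℕ} (h : q ^ (4 * (j + l) + 1) = 1) :
    qPochhammer q q (2 * (j + l)) * q ^ (2 * j ^ 2) =
      qPochhammer q q (2 * l) * (qPochhammer ((q ^ 2) ^ (j + l))⁻¹ (q ^ 2) j *
        qPochhammer ((q ^ 2) ^ (j + l + 1)) (q ^ 2) j) := by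
  -- The tail `(q^(2l+1); q)_{2j}` is split by parity of the exponent: reversing the odd exponents
  -- uses the root of unity, the even ones reverse for any `q ≠ 0`.
  have h1 := qPochhammer_reverse hq (q * q ^ (2 * l)) ((q ^ 2) ^ (j + l + 1)) j (by
    linear_combination q ^ 2 * h)
  have h2 := qPochhammer_reverse hq (q * q ^ (2 * l) * q) ((q ^ 2) ^ (j + l))⁻¹ j (by
    field_simp; ring)
  rw [mul_add 2, add_comm (2 * j), qPochhammer_add q q (2 * l), qPochhammer_two_mul _ q j]
  set A := qPochhammer (q * q ^ (2 * l)) (q ^ 2) j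
  set B := qPochhammer (q * q ^ (2 * l) * q) (q ^ 2) j
  set C := qPochhammer ((q ^ 2) ^ (j + l + 1)) (q ^ 2) j
  set D := qPochhammer ((q ^ 2) ^ (j + l))⁻¹ (q ^ 2) j
  have h3 : A * B * q ^ (2 * j) = q ^ (4 * l * j + 3 * j + 2 * j ^ 2) * (D * C) := by
    have := congrArg₂ (· * ·) h1 h2
    simp only [neg_pow (q * q ^ (2 * l)), neg_pow (q * q ^ (2 * l) * q)] at this
    have hs : ((-1 : K) ^ j) ^ 2 = 1 := by rw [← pow_mul, mul_comm, pow_mul]; simp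
    calc A * B * q ^ (2 * j) = (A * q ^ j) * (B * q ^ j) := by ring
      _ = ((-1) ^ j) ^ 2 * (q ^ (4 * l * j + 3 * j + 2 * j ^ 2) * (D * C)) := by
        rw [this]; ring
      _ = _ := by rw [hs, one_mul]
  have h4 : q ^ (4 * l * j + 3 * j + 2 * j ^ 2) * q ^ (2 * j ^ 2) = q ^ (2 * j) := by
    have : q ^ (4 * l * j + 3 * j + 2 * j ^ 2) * q ^ (2 * j ^ 2) =
        (q ^ (4 * (j + l) + 1)) ^ j * q ^ (2 * j) := by ring
    rw [this, h, one_pow, one_mul]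
  apply mul_right_cancel₀ (pow_ne_zero (2 * j) hq)
  linear_combination qPochhammer q q (2 * l) * q ^ (2 * j ^ 2) * h3 +
    qPochhammer q q (2 * l) * D * C * h4

end Reversal

/-! ### The double sum at a primitive root of unity. -/

section RootOfUnity

variable {K : Type*} [Field K] {q : K} {n : ℕ}

lemma IsPrimitiveRoot.pow_two_pow_of_odd (hq : IsPrimitiveRoot q n) (hn : Odd n) (k : ℕ) :
    IsPrimitiveRoot (q ^ 2 ^ k) n :=
  hq.pow_of_coprime _ (Nat.Coprime.pow_left k (Nat.coprime_two_left.2 hn))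

lemma IsPrimitiveRoot.neg_pow_ne_one [CharZero K] (hq : IsPrimitiveRoot q n) (hn : Odd n)
    (i : ℕ) : -q ^ i ≠ 1 := fun h => by
  have h1 : q ^ i = -1 := by linear_combination -h
  have h2 : (q ^ i) ^ n = 1 := by rw [← pow_mul, mul_comm, pow_mul, hq.pow_eq_one, one_pow]
  rw [h1, hn.neg_one_pow] at h2
  norm_num at h2

lemma IsPrimitiveRoot.qPochhammer_neg_ne_zero [CharZero K] (hq : IsPrimitiveRoot q n) (hn : Odd n)
    (a b k : ℕ) : qPochhammer (-q ^ a) (q ^ b) k ≠ 0 :=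
  qPochhammer_ne_zero fun i _ => by
    have := hq.neg_pow_ne_one hn (a + b * i)
    rwa [pow_add, pow_mul, ← neg_mul] at this

lemma IsPrimitiveRoot.qPochhammer_self_ne_zero (hq : IsPrimitiveRoot q n) {k : ℕ} (hk : k < n) :
    qPochhammer q q k ≠ 0 :=
  _root_.qPochhammer_self_ne_zero fun i hi =>
    hq.pow_ne_one_of_pos_of_lt (Nat.succ_ne_zero i) (by omega)

/-- The double summand obtained by expanding the summand of `truncatedSum` by means of
`sum_saalschutzTerm`. -/
def doubleTerm (q : K) (k j : ℕ) : K :=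
  (-1) ^ k * (qPochhammer q (q ^ 2) k * qPochhammer (-q) (q ^ 2) k /
    (qPochhammer (q ^ 2) (q ^ 2) k * qPochhammer (-q ^ 2) (q ^ 2) k)) * saalschutzTerm q k j

lemma truncatedSum_eq_sum_doubleTerm {N : ℕ} (hq : IsPrimitiveRoot q (2 * N + 1)) (hN : 0 < N) :
    truncatedSum q (2 * N + 1) =
      ∑ j ∈ Finset.range (N + 1), ∑ k ∈ Finset.range (N + 1), doubleTerm q k j := by
  have q0 : q ≠ 0 := hq.ne_zero (by omega)
  have hp : IsPrimitiveRoot (q ^ 2) (2 * N + 1) := hq.pow_two_pow_of_odd ⟨N, rfl⟩ 1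
  rw [Finset.sum_comm, truncatedSum]
  have : (2 * N + 1 - 1) / 2 = N := by omega
  rw [this]
  refine Finset.sum_congr rfl fun k hk => ?_
  have hk := Finset.mem_range.1 hk
  have h2 : ∀ i < N + 1, (q ^ 2) ^ (i + 1) ≠ 1 := fun i hi =>
    hp.pow_ne_one_of_pos_of_lt (Nat.succ_ne_zero i) (by omega)
  have h1 : ∀ i < k, q * (q ^ 2) ^ i ≠ 1 := fun i hi h =>
    hq.pow_ne_one_of_pos_of_lt (l := 2 * i + 1) (by omega) (by omega) (by
      rw [← h]; ring)
  simp only [doubleTerm]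
  rw [← Finset.mul_sum,
    sum_saalschutzTerm q0 k h1 (fun i hi => h2 i (by omega)) (N + 1) hk h2]
  have e4 : q ^ 4 = (q ^ 2) ^ 2 := by ring
  rw [e4, qPochhammer_sq q (q ^ 2), qPochhammer_sq (q ^ 2) (q ^ 2), neg_pow]
  have : qPochhammer (q ^ 2) (q ^ 2) k ≠ 0 := hp.qPochhammer_self_ne_zero (by omega)
  field_simp

lemma doubleTerm_eq_zero_of_lt (hq : q ≠ 0) {k j : ℕ} (h : k < j) : doubleTerm q k j = 0 := by
  rw [doubleTerm, saalschutzTerm_eq_zero hq h, mul_zero]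

/-- `(q;q²)_k` and `(q^(2k+1);q²)_j` combine to `(q;q²)_{k+j}`, which then contains `1 - q^(2N+1)`.
-/
lemma doubleTerm_eq_zero_of_gt {N : ℕ} (hq : q ^ (2 * N + 1) = 1) {k j : ℕ} (h : N < k + j) :
    doubleTerm q k j = 0 := by
  have h0 : qPochhammer q (q ^ 2) k * qPochhammer (q * (q ^ 2) ^ k) (q ^ 2) j = 0 := by
    rw [← qPochhammer_add]
    exact qPochhammer_eq_zero h (by rw [← hq]; ring)
  rcases mul_eq_zero.1 h0 with h0 | h0 <;> simp [doubleTerm, saalschutzTerm, h0]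

/-- With `k = j + i` and `N = 2j + i + l`, reversal isolates the dependence on `i` and `l` in a
convolution summand. The factor `q^(i+l) = q^(N-2j)` does not depend on `k` and clears negative
powers. -/
lemma doubleTerm_eq [CharZero K] {i j l : ℕ}
    (hq : IsPrimitiveRoot q (2 * (2 * j + i + l) + 1)) (hN : 0 < 2 * j + i + l) :
    doubleTerm q (j + i) j * q ^ (i + l) =
      qPochhammer (q ^ 2) (q ^ 2) (2 * j + i + l) / qPochhammer (-q) (q ^ 2) (2 * j + i + l) *
      (qPochhammer q (q ^ 2) j * qPochhammer (-q) (q ^ 2) j ^ 2 /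
        qPochhammer (q ^ 2) (q ^ 2) j ^ 3 * q ^ (2 * j ^ 2)) *
      (qBinomialCoeff (-q * (q ^ 2) ^ j) (q ^ 2) i *
        qBinomialCoeff (-q * (q ^ 2) ^ j) (q ^ 2) l * q ^ l) := by
  have q0 : q ≠ 0 := hq.ne_zero (by omega)
  have ho : Odd (2 * (2 * j + i + l) + 1) := ⟨_, rfl⟩
  have hp : IsPrimitiveRoot (q ^ 2) (2 * (2 * j + i + l) + 1) := hq.pow_two_pow_of_odd ho 1
  have r1 := qPochhammer_odd_reverse q0 (m := (j + i) + j) (l := l) (by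
    rw [← hq.pow_eq_one]; congr 1; ring)
  rw [qPochhammer_add q _ (j + i) j] at r1
  have r2 := qPochhammer_inv_mul q0 i j
  have r3 := qPochhammer_neg_reverse q0 (m := j + i) (l := j + l) (by
    rw [← hq.pow_eq_one]; congr 1; ring)
  have e1 : j + i + j + l = 2 * j + i + l := by ring
  have e2 : j + i + (j + l) = 2 * j + i + l := by ring
  rw [e1] at r1
  rw [e2] at r3
  have hl : qPochhammer (q ^ 2) (q ^ 2) l ≠ 0 := hp.qPochhammer_self_ne_zero (by omega)
  have hi : qPochhammer (q ^ 2) (q ^ 2) i ≠ 0 := hp.qPochhammer_self_ne_zero (by omega)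
  have hj : qPochhammer (q ^ 2) (q ^ 2) j ≠ 0 := hp.qPochhammer_self_ne_zero (by omega)
  have hji : qPochhammer (q ^ 2) (q ^ 2) (j + i) ≠ 0 := hp.qPochhammer_self_ne_zero (by omega)
  have hN1 : ∀ m, qPochhammer (-q) (q ^ 2) m ≠ 0 := fun m => by
    simpa using hq.qPochhammer_neg_ne_zero ho 1 2 m
  have hN2 : ∀ m, qPochhammer (-q ^ 2) (q ^ 2) m ≠ 0 := hq.qPochhammer_neg_ne_zero ho 2 2
  have hB : ∀ m, qPochhammer (-q * (q ^ 2) ^ j) (q ^ 2) m ≠ 0 := fun m h => hN1 (j + m) (by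
    rw [qPochhammer_add, h, mul_zero])
  rw [qPochhammer_add _ _ j l] at r3
  have hpow : q ^ ((j + i + j) ^ 2) * (q ^ 2) ^ j * q ^ i =
      q ^ (2 * j ^ 2) * q ^ (2 * i * j + j + j ^ 2) * q ^ ((j + i) * (j + i + 1)) := by ring
  have hs : (-1 : K) ^ (j + i) * (-1) ^ (j + i + j) = (-1) ^ j := by
    rw [← pow_add, show j + i + (j + i + j) = j + 2 * (j + i) by ring, pow_add, pow_mul]
    simp
  have hD : qPochhammer ((q ^ 2) ^ (j + i))⁻¹ (q ^ 2) j ≠ 0 := fun h => hji (by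
    rw [r2, h]; ring)
  have r1' := (eq_div_iff hl).2 r1
  have r3' := (eq_div_iff (mul_ne_zero (hN1 j) (hB l))).2 r3
  calc doubleTerm q (j + i) j * q ^ (i + l)
      = (-1) ^ (j + i) * (qPochhammer q (q ^ 2) (j + i) *
          qPochhammer (q * (q ^ 2) ^ (j + i)) (q ^ 2) j) *
          qPochhammer (-q) (q ^ 2) (j + i) * qPochhammer ((q ^ 2) ^ (j + i))⁻¹ (q ^ 2) j *
          qPochhammer q (q ^ 2) j / (qPochhammer (q ^ 2) (q ^ 2) (j + i) *
            qPochhammer (-q ^ 2) (q ^ 2) (j + i) * qPochhammer (q ^ 2) (q ^ 2) j ^ 3) *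
          (q ^ 2) ^ j * q ^ i * q ^ l := by
        rw [doubleTerm, saalschutzTerm, pow_add q i l]
        simp only [div_eq_mul_inv, mul_inv]
        ring
    _ = _ := by
        rw [r1', r2, r3', qPochhammer_add (-q) _ j i, qBinomialCoeff, qBinomialCoeff]
        have hBi := hB i
        have hBl := hB l
        have hNj := hN1 j
        have hNN := hN1 (2 * j + i + l)
        generalize qPochhammer ((q ^ 2) ^ (j + i))⁻¹ (q ^ 2) j = D at *
        generalize qPochhammer (-q * (q ^ 2) ^ j) (q ^ 2) i = Bi at *
        generalize qPochhammer (-q * (q ^ 2) ^ j) (q ^ 2) l = Bl at *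
        generalize qPochhammer (-q) (q ^ 2) j = Nj at *
        generalize qPochhammer (-q) (q ^ 2) (2 * j + i + l) = NN at *
        generalize qPochhammer (q ^ 2) (q ^ 2) j = pj at *
        generalize qPochhammer (q ^ 2) (q ^ 2) i = pi at *
        generalize qPochhammer (q ^ 2) (q ^ 2) l = pl at *
        generalize qPochhammer (q ^ 2) (q ^ 2) (2 * j + i + l) = pN at *
        generalize qPochhammer q (q ^ 2) j = Q at *
        have hp1 : q ^ (2 * i * j + j + j ^ 2) ≠ 0 := pow_ne_zero _ q0
        have hp2 : q ^ ((j + i) * (j + i + 1)) ≠ 0 := pow_ne_zero _ q0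
        have hs0 : (-1 : K) ^ j ≠ 0 := pow_ne_zero _ (by norm_num)
        generalize q ^ (2 * i * j + j + j ^ 2) = E1 at *
        generalize q ^ ((j + i) * (j + i + 1)) = E2 at *
        generalize q ^ ((j + i + j) ^ 2) = E3 at *
        generalize q ^ (2 * j ^ 2) = E4 at *
        generalize (q ^ 2) ^ j = E5 at *
        generalize q ^ i = E6 at *
        generalize q ^ l = E7 at *
        generalize (-1 : K) ^ (j + i) = S1 at *
        generalize (-1 : K) ^ (j + i + j) = S2 at *
        generalize (-1 : K) ^ j = S3 at *
        clear r1 r2 r3 r1' r3'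
        have : S1 * S2 * (E3 * E5 * E6) = S3 * (E4 * E1 * E2) := by rw [hs, hpow]
        field_simp
        linear_combination pN * Q * E7 * this

lemma sum_doubleTerm [CharZero K] {j L : ℕ} (hq : IsPrimitiveRoot q (2 * (2 * j + L) + 1))
    (hN : 0 < 2 * j + L) :
    (∑ k ∈ Finset.range (2 * j + L + 1), doubleTerm q k j) * q ^ L =
      qPochhammer (q ^ 2) (q ^ 2) (2 * j + L) / qPochhammer (-q) (q ^ 2) (2 * j + L) *
      (qPochhammer q (q ^ 2) j * qPochhammer (-q) (q ^ 2) j ^ 2 /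
        qPochhammer (q ^ 2) (q ^ 2) j ^ 3 * q ^ (2 * j ^ 2)) *
      qBinomialCoeff (-q * (q ^ 2) ^ j) q L := by
  have q0 : q ≠ 0 := hq.ne_zero (by omega)
  have hp : IsPrimitiveRoot (q ^ 2) (2 * (2 * j + L) + 1) := hq.pow_two_pow_of_odd ⟨_, rfl⟩ 1
  -- Only `j ≤ k ≤ j + L` contributes: smaller `k` vanish by termination, larger ones by `q^n = 1`.
  rw [← sum_qBinomialCoeff_sq _ _ _
    (fun i hi => hq.pow_ne_one_of_pos_of_lt (Nat.succ_ne_zero i) (by omega))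
    (fun i hi => hp.pow_ne_one_of_pos_of_lt (Nat.succ_ne_zero i) (by omega)),
    show 2 * j + L + 1 = j + ((L + 1) + j) by ring, Finset.sum_range_add, Finset.sum_range_add,
    Finset.sum_eq_zero fun k hk => doubleTerm_eq_zero_of_lt q0 (Finset.mem_range.1 hk),
    Finset.sum_eq_zero (s := Finset.range j) fun k _ =>
      doubleTerm_eq_zero_of_gt hq.pow_eq_one (by omega), zero_add, add_zero, Finset.sum_mul,
    Finset.mul_sum]
  refine Finset.sum_congr rfl fun i hi => ?_
  obtain ⟨l, rfl⟩ : ∃ l, L = i + l := ⟨L - i, by have := Finset.mem_range.1 hi; omega⟩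
  rw [← add_assoc] at hq hN
  rw [doubleTerm_eq hq hN, Nat.add_sub_cancel_left, add_assoc]

/-- For `j ≤ M` the length `L = 2(M - j)` is even, and `qPochhammer_self_reverse` turns the
denominator `(q;q)_L` into the numerator parameters `p^(-M)`, `p^(M+1)` with `p = q²`. For `j > M`
both sides vanish. -/
lemma sum_doubleTerm_eq_watsonTerm [CharZero K] {M : ℕ} (hM : 0 < M)
    (hq : IsPrimitiveRoot q (4 * M + 1)) (j : ℕ) :
    (∑ k ∈ Finset.range (2 * M + 1), doubleTerm q k j) * q ^ (2 * M) =
      qPochhammer (-q) q (2 * M) ^ 2 / qPochhammer (-q) (q ^ 2) (2 * M) *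
        watsonTerm (q ^ 2) M j := by
  have q0 : q ≠ 0 := hq.ne_zero (by omega)
  have ho : Odd (4 * M + 1) := ⟨2 * M, by ring⟩
  have hp : IsPrimitiveRoot (q ^ 2) (4 * M + 1) := hq.pow_two_pow_of_odd ho 1
  rcases lt_or_ge M j with h | h
  · rw [watsonTerm_eq_zero (pow_ne_zero 2 q0) h, Finset.sum_eq_zero, zero_mul, mul_zero]
    intro k _
    rcases lt_or_ge k j with hk | hk
    · exact doubleTerm_eq_zero_of_lt q0 hk
    · exact doubleTerm_eq_zero_of_gt (N := 2 * M) (by rw [← hq.pow_eq_one]; congr 1; ring)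
        (by omega)
  · obtain ⟨l, rfl⟩ := Nat.exists_eq_add_of_le h
    have hs := sum_doubleTerm (q := q) (j := j) (L := 2 * l) (by convert hq using 1; ring)
      (by omega)
    have hr := qPochhammer_self_reverse q0 hq.pow_eq_one
    have hself := qPochhammer_sq q q (2 * (j + l))
    have hneg : qPochhammer (-q) q (2 * (j + l)) = qPochhammer (-q) (q ^ 2) j *
        qPochhammer (-q ^ 2) (q ^ 2) j * qPochhammer (-q * (q ^ 2) ^ j) q (2 * l) := by
      rw [mul_add, qPochhammer_add, qPochhammer_two_mul, ← pow_mul, neg_mul q q, ← pow_two]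
    rw [← mul_add] at hs
    have c1 : qPochhammer q q (2 * l) ≠ 0 := hq.qPochhammer_self_ne_zero (by omega)
    have c2 : qPochhammer (q ^ 2) (q ^ 2) j ≠ 0 := hp.qPochhammer_self_ne_zero (by omega)
    have c3 : qPochhammer (-q) (q ^ 2) j ≠ 0 := by
      simpa using hq.qPochhammer_neg_ne_zero ho 1 2 j
    have c4 : qPochhammer (-q) (q ^ 2) (2 * (j + l)) ≠ 0 := by
      simpa using hq.qPochhammer_neg_ne_zero ho 1 2 (2 * (j + l))
    have c5 : qPochhammer (-q ^ 2) (q ^ 2) j ≠ 0 := hq.qPochhammer_neg_ne_zero ho 2 2 j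
    rw [show q ^ (2 * (j + l)) = q ^ (2 * l) * (q ^ 2) ^ j by ring, ← mul_assoc, hs, watsonTerm,
      qPochhammer_sq q (q ^ 2), qPochhammer_sq (q ^ 2) (q ^ 2), qBinomialCoeff, hself, pow_two
      (qPochhammer (-q) q (2 * (j + l)))]
    nth_rw 3 [hneg]
    generalize qPochhammer ((q ^ 2) ^ (j + l))⁻¹ (q ^ 2) j = D at *
    generalize qPochhammer (-q * (q ^ 2) ^ j) q (2 * l) = B at *
    field_simp
    linear_combination qPochhammer (-q) q (2 * (j + l)) * qPochhammer q (q ^ 2) j * B * hr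

end RootOfUnity

/-! ### Values at the root of unity. -/

section Evaluation

variable {K : Type*} [Field K] [CharZero K] {q : K}

lemma truncatedSum_eq_sum_watsonTerm {M : ℕ} (hM : 0 < M) (hq : IsPrimitiveRoot q (4 * M + 1)) :
    truncatedSum q (4 * M + 1) * q ^ (2 * M) =
      qPochhammer (-q) q (2 * M) ^ 2 / qPochhammer (-q) (q ^ 2) (2 * M) *
        ∑ j ∈ Finset.range (2 * M + 1), watsonTerm (q ^ 2) M j := by
  have e : 4 * M + 1 = 2 * (2 * M) + 1 := by ring
  rw [e, truncatedSum_eq_sum_doubleTerm (e ▸ hq) (by omega), Finset.sum_mul, Finset.mul_sum]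
  exact Finset.sum_congr rfl fun j _ => sum_doubleTerm_eq_watsonTerm hM hq j

lemma truncatedSum_of_five_mod_eight {k : ℕ} (hq : IsPrimitiveRoot q (8 * k + 5)) :
    truncatedSum q (8 * k + 5) = 0 := by
  have e : 8 * k + 5 = 4 * (2 * k + 1) + 1 := by ring
  have q0 : q ≠ 0 := hq.ne_zero (by omega)
  have h4 : IsPrimitiveRoot ((q ^ 2) ^ 2) (8 * k + 5) := by
    rw [← pow_mul]
    exact hq.pow_two_pow_of_odd ⟨4 * k + 2, by ring⟩ 2
  have h := truncatedSum_eq_sum_watsonTerm (q := q) (M := 2 * k + 1) (by omega) (e ▸ hq)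
  rw [sum_watsonTerm_odd (pow_ne_zero 2 q0) (by omega) fun i hi =>
    h4.pow_ne_one_of_pos_of_lt (Nat.succ_ne_zero i) (by omega), mul_zero] at h
  rw [e]
  exact (mul_eq_zero.1 h).resolve_right (pow_ne_zero _ q0)

lemma truncatedSum_of_one_mod_eight {k : ℕ} (hq : IsPrimitiveRoot q (8 * k + 1)) :
    truncatedSum q (8 * k + 1) =
      (qPochhammer q (q ^ 4) k * qPochhammer (q ^ 2) (q ^ 4) k) ^ 2 *
        qPochhammer (-q) q (4 * k) / qPochhammer (q ^ 4) (q ^ 4) (2 * k) ^ 2 *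
          (q ^ (16 * k ^ 2))⁻¹ := by
  -- Here `k = 0` means `n = 1` and `q = 1`, outside the double-sum argument, which needs `q² ≠ 1`.
  rcases Nat.eq_zero_or_pos k with rfl | hk
  · simp [truncatedSum]
  have e : 8 * k + 1 = 4 * (2 * k) + 1 := by ring
  have q0 : q ≠ 0 := hq.ne_zero (by omega)
  have ho : Odd (8 * k + 1) := ⟨4 * k, by ring⟩
  have h4 : IsPrimitiveRoot (q ^ 4) (8 * k + 1) := hq.pow_two_pow_of_odd ho 2
  have e4 : (q ^ 2) ^ 2 = q ^ 4 := by ring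
  have h := truncatedSum_eq_sum_watsonTerm (q := q) (M := 2 * k) (by omega) (e ▸ hq)
  rw [sum_watsonTerm_even (pow_ne_zero 2 q0) (by omega) fun i hi => by
    rw [e4]; exact h4.pow_ne_one_of_pos_of_lt (Nat.succ_ne_zero i) (by omega), ← e, e4] at h
  -- The even-exponent half of `(-q;q)_{4k}` reverses into the upper half of `(-q;q²)_{4k}`.
  have h1 : qPochhammer (-q) q (2 * (2 * k)) =
      q ^ (2 * k * (2 * k + 1)) * qPochhammer (-q) (q ^ 2) (2 * (2 * k)) := by
    have := qPochhammer_neg_reverse q0 (m := 2 * k) (l := 2 * k) (by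
      rw [← hq.pow_eq_one]; congr 1; ring)
    rw [← two_mul] at this
    rw [← this, qPochhammer_two_mul, neg_mul, ← pow_two, mul_comm]
  -- Exponents `1 + 4i` and `8k - 4i` add up to `n`, so `(q;q⁴)_k` reverses into the upper half of
  -- `(q⁴;q⁴)_{2k}`; squaring later removes the sign.
  have h2 := qPochhammer_reverse (pow_ne_zero 2 q0) q (q ^ 4 * (q ^ 4) ^ k) k (by
    linear_combination q ^ 4 * hq.pow_eq_one)
  have h3 := qPochhammer_add (q ^ 4) (q ^ 4) k k
  rw [e4] at h2
  rw [← two_mul] at h3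
  have n1 : qPochhammer (-q) (q ^ 2) (2 * (2 * k)) ≠ 0 := by
    simpa using hq.qPochhammer_neg_ne_zero ho 1 2 (2 * (2 * k))
  have n2 : qPochhammer (q ^ 4) (q ^ 4) (2 * k) ≠ 0 := h4.qPochhammer_self_ne_zero (by omega)
  have n3 : qPochhammer (q ^ 4) (q ^ 4) k ≠ 0 := h4.qPochhammer_self_ne_zero (by omega)
  have h5 : qPochhammer q (q ^ 4) k ^ 2 * q ^ (2 * k) =
      q ^ (4 * k ^ 2) * qPochhammer (q ^ 4 * (q ^ 4) ^ k) (q ^ 4) k ^ 2 := by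
    apply mul_right_cancel₀ (pow_ne_zero (2 * k) q0)
    have := congrArg (· ^ 2) h2
    simp only [neg_pow q k] at this
    have hs : ((-1 : K) ^ k) ^ 2 = 1 := by rw [← pow_mul, mul_comm, pow_mul]; simp
    calc _ = (qPochhammer q (q ^ 4) k * (q ^ 2) ^ k) ^ 2 := by ring
      _ = ((-1) ^ k) ^ 2 * (q ^ (4 * k ^ 2) *
          qPochhammer (q ^ 4 * (q ^ 4) ^ k) (q ^ 4) k ^ 2 * q ^ (2 * k)) := by rw [this]; ring
      _ = _ := by rw [hs, one_mul]
  have h6 : q ^ (20 * k ^ 2) * q ^ (2 * k) = q ^ (4 * k ^ 2) := by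
    have : q ^ (20 * k ^ 2) * q ^ (2 * k) = (q ^ (8 * k + 1)) ^ (2 * k) * q ^ (4 * k ^ 2) := by ring
    rw [this, hq.pow_eq_one, one_pow, one_mul]
  have h7 : q ^ (20 * k ^ 2) * qPochhammer (q ^ 4 * (q ^ 4) ^ k) (q ^ 4) k ^ 2 =
      qPochhammer q (q ^ 4) k ^ 2 := by
    apply mul_right_cancel₀ (pow_ne_zero (2 * k) q0)
    rw [h5, ← h6]
    ring
  rw [← mul_assoc, show 2 * 2 * k = 4 * k by ring] at h h1 n1
  apply mul_right_cancel₀ (pow_ne_zero (4 * k) q0)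
  rw [h, mul_pow, ← h7, pow_two (qPochhammer (-q) q (4 * k))]
  nth_rw 1 [h1]
  rw [h3]
  have n4 : qPochhammer (q ^ 4 * (q ^ 4) ^ k) (q ^ 4) k ≠ 0 := fun h => n2 (by rw [h3, h, mul_zero])
  generalize qPochhammer (q ^ 4 * (q ^ 4) ^ k) (q ^ 4) k = B at *
  generalize qPochhammer (q ^ 4) (q ^ 4) k = A at *
  generalize qPochhammer (-q) (q ^ 2) (4 * k) = C at *
  generalize qPochhammer (-q) q (4 * k) = D at *
  generalize qPochhammer (q ^ 2) (q ^ 4) k = E at *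
  have h8 : q ^ (2 * k * (2 * k + 1)) * (q ^ 2) ^ k * q ^ (16 * k ^ 2) =
    q ^ (20 * k ^ 2) * q ^ (4 * k) := by ring
  have n5 : q ^ (16 * k ^ 2) ≠ 0 := pow_ne_zero _ q0
  generalize q ^ (2 * k * (2 * k + 1)) = E1 at *
  generalize (q ^ 2) ^ k = E2 at *
  generalize q ^ (16 * k ^ 2) = E3 at *
  generalize q ^ (20 * k ^ 2) = E4 at *
  generalize q ^ (4 * k) = E5 at *
  field_simp
  linear_combination D * E ^ 2 * h8

end Evaluation

/-! ### From values at `ζ` to congruences modulo `Φ_n`. -/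

section Transfer

/-- The rational function `A` is regular at `z` and takes the value `v` there. -/
def RegularValue (z : ℂ) (A : RatFunc ℚ) (v : ℂ) : Prop :=
  ∃ a b : ℚ[X], aeval z b ≠ 0 ∧ A * algebraMap ℚ[X] (RatFunc ℚ) b = algebraMap _ _ a ∧
    v * aeval z b = aeval z a

namespace RegularValue

variable {z v w : ℂ} {A B : RatFunc ℚ}

lemma X : RegularValue z RatFunc.X z :=
  ⟨Polynomial.X, 1, by simp, by simp, by simp⟩

lemma one : RegularValue z 1 1 := ⟨1, 1, by simp, by simp, by simp⟩

lemma zero : RegularValue z 0 0 := ⟨0, 1, by simp, by simp, by simp⟩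

lemma neg (hA : RegularValue z A v) : RegularValue z (-A) (-v) := by
  obtain ⟨a, b, h0, h1, h2⟩ := hA
  exact ⟨-a, b, h0, by rw [map_neg, neg_mul, h1], by rw [map_neg, neg_mul, h2]⟩

lemma add (hA : RegularValue z A v) (hB : RegularValue z B w) :
    RegularValue z (A + B) (v + w) := by
  obtain ⟨a, b, h0, h1, h2⟩ := hA
  obtain ⟨c, d, g0, g1, g2⟩ := hB
  refine ⟨a * d + c * b, b * d, by simp [h0, g0], ?_, ?_⟩
  · simp only [map_add, map_mul]
    rw [← h1, ← g1]
    ring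
  · simp only [map_add, map_mul]
    rw [← h2, ← g2]
    ring

lemma sub (hA : RegularValue z A v) (hB : RegularValue z B w) :
    RegularValue z (A - B) (v - w) := by
  rw [sub_eq_add_neg, sub_eq_add_neg]
  exact hA.add hB.neg

lemma mul (hA : RegularValue z A v) (hB : RegularValue z B w) :
    RegularValue z (A * B) (v * w) := by
  obtain ⟨a, b, h0, h1, h2⟩ := hA
  obtain ⟨c, d, g0, g1, g2⟩ := hB
  refine ⟨a * c, b * d, by simp [h0, g0], ?_, ?_⟩
  · rw [map_mul, map_mul, ← h1, ← g1]
    ring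
  · rw [map_mul, map_mul, ← h2, ← g2]
    ring

lemma inv (hA : RegularValue z A v) (hv : v ≠ 0) : RegularValue z A⁻¹ v⁻¹ := by
  obtain ⟨a, b, h0, h1, h2⟩ := hA
  have ha : aeval z a ≠ 0 := h2 ▸ mul_ne_zero hv h0
  have hA : A ≠ 0 := by
    rintro rfl
    rw [zero_mul] at h1
    rw [(map_eq_zero_iff _ (RatFunc.algebraMap_injective ℚ)).1 h1.symm, map_zero] at ha
    exact ha rfl
  refine ⟨b, a, ha, ?_, ?_⟩
  · rw [← h1, inv_mul_cancel_left₀ hA]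
  · rw [← h2, inv_mul_cancel_left₀ hv]

lemma div (hA : RegularValue z A v) (hB : RegularValue z B w) (hw : w ≠ 0) :
    RegularValue z (A / B) (v / w) := by
  rw [div_eq_mul_inv, div_eq_mul_inv]
  exact hA.mul (hB.inv hw)

lemma pow (hA : RegularValue z A v) (k : ℕ) : RegularValue z (A ^ k) (v ^ k) := by
  induction k with
  | zero => simpa using one
  | succ k ih => rw [pow_succ, pow_succ]; exact ih.mul hA

lemma sum {f : ℕ → RatFunc ℚ} {g : ℕ → ℂ} {k : ℕ} (h : ∀ i < k, RegularValue z (f i) (g i)) :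
    RegularValue z (∑ i ∈ Finset.range k, f i) (∑ i ∈ Finset.range k, g i) := by
  induction k with
  | zero => simpa using zero
  | succ k ih =>
    rw [Finset.sum_range_succ, Finset.sum_range_succ]
    exact (ih fun i hi => h i (by omega)).add (h k (by omega))

lemma qPochhammer (hA : RegularValue z A v) (hB : RegularValue z B w) (k : ℕ) :
    RegularValue z (_root_.qPochhammer A B k) (_root_.qPochhammer v w k) := by
  induction k with
  | zero => simpa using one
  | succ k ih =>
    rw [qPochhammer_succ, qPochhammer_succ]
    exact ih.mul (one.sub (hA.mul (hB.pow k)))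

lemma truncatedSum {n : ℕ} (hz : IsPrimitiveRoot z n) (hn : Odd n) :
    RegularValue z (_root_.truncatedSum RatFunc.X n) (_root_.truncatedSum z n) := by
  refine sum fun k hk => ?_
  -- As `n` is odd, `z²` and `z⁴` are again primitive, so `k < n` keeps the denominators nonzero.
  have hkn : k < n := by have := hn.pos; omega
  have h2 : _root_.qPochhammer (z ^ 2) (z ^ 2) k ≠ 0 :=
    (hz.pow_two_pow_of_odd hn 1).qPochhammer_self_ne_zero hkn
  have h4 : _root_.qPochhammer (z ^ 4) (z ^ 4) k ≠ 0 :=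
    (hz.pow_two_pow_of_odd hn 2).qPochhammer_self_ne_zero hkn
  exact ((((X.qPochhammer (X.pow 2) k).pow 2).mul ((X.pow 2).qPochhammer (X.pow 4) k)).div
    ((((X.pow 2).qPochhammer (X.pow 2) k).pow 2).mul ((X.pow 4).qPochhammer (X.pow 4) k))
    (mul_ne_zero (pow_ne_zero 2 h2) h4)).mul (X.neg.pow k)

/-- If `A - B = a / b` with `b(z) ≠ 0`, equal values give `a(z) = 0`; then `num * b = a * denom`
makes `z` a root of the reduced numerator, which the minimal polynomial divides. -/
lemma ratFuncModEq {n : ℕ} (hz : IsPrimitiveRoot z n) (hn : 0 < n) (hA : RegularValue z A v)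
    (hB : RegularValue z B v) : RatFuncModEq (cyclotomic n ℚ) A B := by
  obtain ⟨a, b, h0, h1, h2⟩ := hA.sub hB
  rw [RatFuncModEq, cyclotomic_eq_minpoly_rat hz hn]
  apply minpoly.dvd
  generalize A - B = C at *
  have hd : algebraMap ℚ[X] (RatFunc ℚ) C.denom ≠ 0 :=
    (map_ne_zero_iff _ (RatFunc.algebraMap_injective ℚ)).2 C.denom_ne_zero
  have h3 : C.num * b = a * C.denom := by
    apply RatFunc.algebraMap_injective ℚ
    rw [map_mul, map_mul, ← h1]
    nth_rw 2 [← RatFunc.num_div_denom C]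
    field_simp
  have h4 := congrArg (aeval z) h3
  rw [map_mul, map_mul, ← h2, sub_self, zero_mul, zero_mul] at h4
  exact (mul_eq_zero.1 h4).resolve_right h0

end RegularValue

end Transfer

theorem theorem5 (n : ℕ) (hn : 0 < n) (hn4 : n ≡ 1 [MOD 4]) :
    (n ≡ 1 [MOD 8] →
      RatFuncModEq (cyclotomic n ℚ)
        (truncatedSum (RatFunc.X : RatFunc ℚ) n)
        ((qPochhammer RatFunc.X (RatFunc.X ^ 4) ((n - 1) / 8) *
              qPochhammer (RatFunc.X ^ 2) (RatFunc.X ^ 4) ((n - 1) / 8)) ^ 2 *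
            qPochhammer (-RatFunc.X) RatFunc.X ((n - 1) / 2) /
            qPochhammer (RatFunc.X ^ 4) (RatFunc.X ^ 4) ((n - 1) / 4) ^ 2 *
          (RatFunc.X : RatFunc ℚ) ^ (-((1 - (n : ℤ)) ^ 2 / 4)))) ∧
    (n ≡ 5 [MOD 8] →
      RatFuncModEq (cyclotomic n ℚ) (truncatedSum (RatFunc.X : RatFunc ℚ) n) 0) := by
  have hz := Complex.isPrimitiveRoot_exp n hn.ne'
  generalize Complex.exp (2 * Real.pi * Complex.I / n) = z at hz
  have hodd : Odd n := by
    rw [Nat.odd_iff]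
    have : n % 4 = 1 := hn4
    omega
  have hS := RegularValue.truncatedSum hz hodd
  constructor
  · intro h
    have h : n % 8 = 1 := h
    obtain ⟨k, rfl⟩ : ∃ k, n = 8 * k + 1 := ⟨n / 8, by omega⟩
    -- The integer division in the exponent is exact: `(8k)² / 4 = 16k²`.
    have e : (1 - ((8 * k + 1 : ℕ) : ℤ)) ^ 2 / 4 = ((16 * k ^ 2 : ℕ) : ℤ) := by
      rw [Int.ediv_eq_iff_eq_mul_left (by norm_num)]
      · push_cast
        ring
      · exact ⟨16 * k ^ 2, by push_cast; ring⟩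
    rw [e, zpow_neg, zpow_natCast, show (8 * k + 1 - 1) / 8 = k by omega,
      show (8 * k + 1 - 1) / 2 = 4 * k by omega, show (8 * k + 1 - 1) / 4 = 2 * k by omega]
    rw [truncatedSum_of_one_mod_eight hz] at hS
    have h4 : qPochhammer (z ^ 4) (z ^ 4) (2 * k) ≠ 0 :=
      (hz.pow_two_pow_of_odd hodd 2).qPochhammer_self_ne_zero (by omega)
    open RegularValue in
    exact hS.ratFuncModEq hz hn
      ((((((X.qPochhammer (X.pow 4) k).mul ((X.pow 2).qPochhammer (X.pow 4) k)).pow 2).mul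
        (X.neg.qPochhammer X (4 * k))).div (((X.pow 4).qPochhammer (X.pow 4) (2 * k)).pow 2)
        (pow_ne_zero 2 h4)).mul ((X.pow _).inv (pow_ne_zero _ (hz.ne_zero hn.ne'))))
  · intro h
    have h : n % 8 = 5 := h
    obtain ⟨k, rfl⟩ : ∃ k, n = 8 * k + 5 := ⟨n / 8, by omega⟩
    rw [truncatedSum_of_five_mod_eight hz] at hS
    exact hS.ratFuncModEq hz hn .zero
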